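/- Let $a>0$ and $b>-2$ be real numbers. For every real $x\ge 0$ the series $$\mathcal K_{a,b}(x)=\sum_{i=1}^{\infty} i^{\,b+1}\prod_{j=1}^{i}\frac{x}{x+j^{a}}$$ converges. Put $$L_{a,b}(x)=\frac{\Gamma\!\left(\frac{b+2}{a+1}\right)}{(a+1)^{1-\frac{b+2}{a+1}}}\;x^{\frac{b+2}{a+1}} .$$ Then, as $x\to\infty$ with $a,b$ fixed, $\mathcal K_{a,b}(x)$ has the asymptotic expansion with leading term $L_{a,b}(x)$, that is, $\mathcal K_{a,b}(x)/L_{a,b}(x)\to 1$, and with the following remainder: $$\mathcal K_{a,b}(x)=L_{a,b}(x)+O\!\left(x^{\frac{b+1}{a+1}}\right)\quad\text{if } b>-1,$$ $$\mathcal K_{a,b}(x)=L_{a,b}(x)+O(1)\quad\text{if } -2<b\le -1 .$$ The constants in the $O$-terms may depend on $a$ and $b$. -/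

import Mathlib

open Filter Asymptotics

noncomputable section

/-- The term of index `i` (for `i ≥ 1`) of the series defining `𝒦_{a,b}(x)`:
`i ^ (b + 1) * ∏_{j = 1}^{i} x / (x + j ^ a)`, with real powers. -/
def kTerm (a b x : ℝ) (i : ℕ) : ℝ :=
  (i : ℝ) ^ (b + 1) * ∏ j ∈ Finset.Icc 1 i, x / (x + (j : ℝ) ^ a)

/-- `𝒦_{a,b}(x)`, the sum of `kTerm a b x i` over all integers `i ≥ 1`
(the summation variable is shifted by one). -/
def kSum (a b x : ℝ) : ℝ :=
  ∑' n : ℕ, kTerm a b x (n + 1)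

/-- The leading term `Γ((b+2)/(a+1)) / (a+1)^(1 - (b+2)/(a+1)) * x^((b+2)/(a+1))`. -/
def kLeading (a b x : ℝ) : ℝ :=
  Real.Gamma ((b + 2) / (a + 1)) / (a + 1) ^ (1 - (b + 2) / (a + 1)) *
    x ^ ((b + 2) / (a + 1))

end

/-! For i up to about x^(1/a), ∏ x/(x+j^a) is close to exp(-∑ j^a/x), hence to
exp(-i^(a+1)/((a+1)x)). `abs_prod_sub_exp_le` bounds the error by terms of relative size i^a/x and
i^(2a+1)/x², plus exp(-κi), which covers larger i. Weighted by i^(b+1) and summed, the first two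
errors are O(x^((b+1)/(a+1))) and the last is O(1). The sum ∑ i^(b+1) exp(-i^(a+1)/((a+1)x)) that
remains is compared with its integral over (0, ∞), a Gamma integral equal to `kLeading`, at cost O(1
+ x^((b+1)/(a+1))) by `rpow_mul_exp_sum_sub_integral`. -/

/-! ### Sums against integrals. -/

open MeasureTheory Set in
/-- Comparison of `∑ f` with `∫ f` on `[1, ∞)` when `f` and `f'` are integrable. -/
theorem summable_and_abs_tsum_sub_integral_le {f f' : ℝ → ℝ}
    (hf : ∀ t, 1 ≤ t → HasDerivAt f (f' t) t)
    (hfi : IntegrableOn f (Ioi 1)) (hfi' : IntegrableOn f' (Ioi 1)) :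
    Summable (fun n : ℕ => f (n + 1)) ∧
      |∑' n : ℕ, f (n + 1) - ∫ t in Ioi 1, f t| ≤ ∫ t in Ioi 1, |f' t| := by
  set S : ℕ → Set ℝ := fun n => Ioc ((n : ℝ) + 1) (n + 2) with hS
  have hU : ⋃ n, S n = Ioi 1 := by
    ext t
    simp only [hS, mem_iUnion, mem_Ioc, mem_Ioi]
    constructor
    · rintro ⟨n, h, -⟩
      have : (0 : ℝ) ≤ n := n.cast_nonneg
      linarith
    · intro ht
      have h0 : 2 ≤ ⌈t⌉₊ := by
        have : 1 < ⌈t⌉₊ := Nat.lt_ceil.2 (by simpa using ht)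
        omega
      have h1 := Nat.ceil_lt_add_one (by linarith : (0 : ℝ) ≤ t)
      have h2 := Nat.le_ceil t
      refine ⟨⌈t⌉₊ - 2, ?_, ?_⟩ <;> push_cast [h0] <;> linarith
  have hm : ∀ n, MeasurableSet (S n) := fun n => measurableSet_Ioc
  have hd : Pairwise (Function.onFun Disjoint S) := by
    have h : Monotone (fun n : ℕ => (n : ℝ) + 1) := fun m n h => by
      have : (m : ℝ) ≤ n := by exact_mod_cast h
      simpa using this
    have := h.pairwise_disjoint_on_Ioc_succ
    convert this using 4 with n
    push_cast [Nat.succ_eq_succ]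
    ring
  have hsub : ∀ n, S n ⊆ Ioi 1 := fun n => hU ▸ subset_iUnion S n
  have H1 : HasSum (fun n => ∫ t in S n, f t) (∫ t in Ioi 1, f t) := by
    have := hasSum_integral_iUnion hm hd (by rw [hU]; exact hfi)
    rwa [hU] at this
  have H2 : HasSum (fun n => ∫ t in S n, |f' t|) (∫ t in Ioi 1, |f' t|) := by
    have := hasSum_integral_iUnion hm hd (f := fun t => |f' t|) (by rw [hU]; exact hfi'.abs)
    rwa [hU] at this
  -- `S n` has length one, and f(t) - f(n+1) is the integral of f' over a part of it.
  have key : ∀ n : ℕ, |f (n + 1) - ∫ t in S n, f t| ≤ ∫ t in S n, |f' t| := by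
    intro n
    have hn : (0 : ℝ) ≤ n := n.cast_nonneg
    have hi' : IntegrableOn f' (S n) := hfi'.mono_set (hsub n)
    have hv : volume.real (S n) = 1 := by
      simp [hS, Measure.real, Real.volume_Ioc]
      norm_num
    have hfin : volume (S n) ≠ ⊤ := by simp [hS, Real.volume_Ioc]
    have e : f (n + 1) - ∫ t in S n, f t = ∫ t in S n, (f (n + 1) - f t) := by
      rw [integral_sub (integrableOn_const (C := f (n + 1)) hfin enorm_ne_top) (hfi.mono_set (hsub n)),
        setIntegral_const, hv, one_smul]
    rw [e]
    have := norm_setIntegral_le_of_norm_le_const (μ := volume) (s := S n)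
      (f := fun t => f (n + 1) - f t) (C := ∫ t in S n, |f' t|) (lt_top_iff_ne_top.2 hfin) ?_
    · rwa [hv, mul_one] at this
    · intro t ht
      have h1 : (n : ℝ) + 1 ≤ t := ht.1.le
      have hsub2 : Ioc ((n : ℝ) + 1) t ⊆ S n := Ioc_subset_Ioc_right ht.2
      have hFT : ∫ u in ((n : ℝ) + 1)..t, f' u = f t - f (n + 1) := by
        apply intervalIntegral.integral_eq_sub_of_hasDerivAt
        · intro u hu
          rw [uIcc_of_le h1] at hu
          exact hf u (by linarith [hu.1])
        · rw [intervalIntegrable_iff_integrableOn_Ioc_of_le h1]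
          exact hi'.mono_set hsub2
      rw [norm_sub_rev, ← hFT]
      refine (intervalIntegral.norm_integral_le_integral_norm h1).trans ?_
      rw [intervalIntegral.integral_of_le h1]
      exact setIntegral_mono_set hi'.abs (Eventually.of_forall fun _ => abs_nonneg _)
        hsub2.eventuallyLE
  have H3 : Summable (fun n : ℕ => f (n + 1) - ∫ t in S n, f t) :=
    Summable.of_norm_bounded H2.summable key
  have H4 : Summable (fun n : ℕ => f (n + 1)) := by
    simpa using H3.add H1.summable
  refine ⟨H4, ?_⟩
  rw [← H1.tsum_eq, ← H2.tsum_eq, ← H4.tsum_sub H1.summable]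
  exact tsum_of_norm_bounded (f := fun n : ℕ => f (n + 1) - ∫ t in S n, f t)
    H2.summable.hasSum key

-- The derivative is s·G - cq·H. Over (0, ∞) the integral of cq·H is exactly a multiple of c^(-s/q),
-- and so is that of G when s > 0. When s < 0, dropping the exponential leaves |s|∫ t^(s-1) = 1 on
-- (1, ∞). The missing piece on (0, 1] costs at most 1/(s+1). The constant is uniform in c.
open MeasureTheory Set Real in
theorem rpow_mul_exp_sum_sub_integral {q s : ℝ} (hq : 1 ≤ q) (hs : -1 < s) :
    ∃ C, 0 ≤ C ∧ ∀ c : ℝ, 0 < c →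
      Summable (fun n : ℕ => ((n : ℝ) + 1) ^ s * exp (-c * ((n : ℝ) + 1) ^ q)) ∧
      |∑' n : ℕ, ((n : ℝ) + 1) ^ s * exp (-c * ((n : ℝ) + 1) ^ q)
        - ∫ t in Ioi (0 : ℝ), t ^ s * exp (-c * t ^ q)| ≤ C * (1 + c ^ (-s / q)) := by
  have hq0 : 0 < q := by linarith
  -- This value matters only for s > 0; for s < 0 it is negative, hence |A| in the constant.
  set A := |s| * (1 / q * Gamma (s / q)) with hA
  set B := q * (1 / q * Gamma ((s + q) / q)) with hB
  have hB0 : 0 ≤ B := by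
    have := Gamma_nonneg_of_nonneg (s := (s + q) / q) (div_nonneg (by linarith) hq0.le)
    positivity
  refine ⟨1 / (s + 1) + 1 + |A| + B, by have : 0 < s + 1 := by linarith
                                        positivity, fun c hc => ?_⟩
  set F : ℝ → ℝ := fun t => t ^ s * exp (-c * t ^ q) with hF
  set G : ℝ → ℝ := fun t => t ^ (s - 1) * exp (-c * t ^ q) with hG
  set H : ℝ → ℝ := fun t => t ^ (s + q - 1) * exp (-c * t ^ q) with hH
  have h01 : Ioi (1 : ℝ) ⊆ Ioi 0 := Ioi_subset_Ioi zero_le_one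
  have hFi : IntegrableOn F (Ioi 0) := integrableOn_rpow_mul_exp_neg_mul_rpow hs hq0 hc
  have hHi : IntegrableOn H (Ioi 0) :=
    integrableOn_rpow_mul_exp_neg_mul_rpow (by linarith) hq0 hc
  have hGi : IntegrableOn G (Ioi 1) := by
    refine (hFi.mono_set h01).mono' (by fun_prop) ?_
    refine (ae_restrict_iff' measurableSet_Ioi).2 (Eventually.of_forall fun t ht => ?_)
    have ht' : (1 : ℝ) < t := ht
    have ht0 : 0 < t := by linarith
    rw [norm_of_nonneg (by positivity)]
    exact mul_le_mul_of_nonneg_right (rpow_le_rpow_of_exponent_le ht'.le (by linarith))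
      (exp_pos _).le
  have hder : ∀ t, 1 ≤ t → HasDerivAt F (s * G t - c * q * H t) t := by
    intro t ht
    have ht0 : 0 < t := by linarith
    have h1 := (hasDerivAt_rpow_const (x := t) (p := s) (Or.inl ht0.ne')).mul
      ((hasDerivAt_rpow_const (x := t) (p := q) (Or.inl ht0.ne')).const_mul (-c)).exp
    refine HasDerivAt.congr_deriv (f := F) h1 ?_
    simp only [hG, hH]
    rw [add_sub_assoc, rpow_add ht0]
    ring
  have hDi : IntegrableOn (fun t => s * G t - c * q * H t) (Ioi 1) :=
    (hGi.const_mul s).sub ((hHi.mono_set h01).const_mul _)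
  obtain ⟨h1, h2⟩ := summable_and_abs_tsum_sub_integral_le hder (hFi.mono_set h01) hDi
  refine ⟨h1, ?_⟩
  have hsplit : ∫ t in Ioi 0, F t = (∫ t in Ioc 0 1, F t) + ∫ t in Ioi 1, F t := by
    rw [← Ioc_union_Ioi_eq_Ioi (zero_le_one (α := ℝ))]
    exact setIntegral_union Ioc_disjoint_Ioi_same measurableSet_Ioi
      (hFi.mono_set Ioc_subset_Ioi_self) (hFi.mono_set h01)
  have hcp : 0 < c ^ (-s / q) := by positivity
  have hpiece : |∫ t in Ioc 0 1, F t| ≤ 1 / (s + 1) := by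
    have hI : IntegrableOn (fun t : ℝ => t ^ s) (Ioc 0 1) :=
      (intervalIntegrable_iff_integrableOn_Ioc_of_le zero_le_one).1
        (intervalIntegral.intervalIntegrable_rpow' hs)
    have hv : ∫ t in Ioc (0 : ℝ) 1, t ^ s = 1 / (s + 1) := by
      rw [← intervalIntegral.integral_of_le zero_le_one, integral_rpow (Or.inl hs)]
      simp [zero_rpow (by linarith : s + 1 ≠ 0)]
    rw [← hv]
    refine norm_integral_le_of_norm_le (f := F) hI ?_
    refine (ae_restrict_iff' measurableSet_Ioc).2 (Eventually.of_forall fun t ht => ?_)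
    have ht0 : 0 < t := ht.1
    rw [norm_of_nonneg (by positivity)]
    refine mul_le_of_le_one_right (by positivity) (exp_le_one_iff.2 ?_)
    have : 0 < c * t ^ q := by positivity
    linarith
  have hHle : c * q * ∫ t in Ioi 1, H t ≤ B * c ^ (-s / q) := by
    have h : ∫ t in Ioi 1, H t ≤ ∫ t in Ioi 0, H t := by
      refine setIntegral_mono_set hHi ?_ h01.eventuallyLE
      refine (ae_restrict_iff' measurableSet_Ioi).2 (Eventually.of_forall fun t ht => ?_)
      have : (0 : ℝ) < t := ht
      show 0 ≤ H t
      positivity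
    refine (mul_le_mul_of_nonneg_left h (by positivity)).trans_eq ?_
    rw [integral_rpow_mul_exp_neg_mul_rpow hq0 (by linarith) hc]
    have : c ^ (-s / q) = c * c ^ (-(s + q - 1 + 1) / q) := by
      nth_rewrite 2 [← rpow_one c]
      rw [← rpow_add hc]
      congr 1
      field_simp
      ring
    rw [this, hB, sub_add_cancel]
    ring
  have hGle : |s| * ∫ t in Ioi 1, G t ≤ 1 + |A| * c ^ (-s / q) := by
    rcases lt_trichotomy s 0 with h | h | h
    · have hle : ∫ t in Ioi 1, G t ≤ ∫ t in Ioi (1 : ℝ), t ^ (s - 1) := by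
        refine setIntegral_mono_on hGi (integrableOn_Ioi_rpow_of_lt (by linarith) one_pos)
          measurableSet_Ioi fun t ht => ?_
        have ht0 : (0 : ℝ) < t := h01 ht
        refine mul_le_of_le_one_right (by positivity) (exp_le_one_iff.2 ?_)
        have : 0 < c * t ^ q := by positivity
        linarith
      rw [integral_Ioi_rpow_of_lt (by linarith) one_pos, one_rpow, sub_add_cancel] at hle
      have h3 : |s| * ∫ t in Ioi 1, G t ≤ 1 := by
        refine (mul_le_mul_of_nonneg_left hle (abs_nonneg s)).trans_eq ?_
        rw [abs_of_neg h, neg_div, neg_mul_neg, mul_one_div_cancel h.ne]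
      have : 0 ≤ |A| * c ^ (-s / q) := by positivity
      linarith
    · have : 0 ≤ |A| * c ^ (-s / q) := by positivity
      rw [h, abs_zero, zero_mul]
      rw [h] at this
      linarith
    · have hG0 : IntegrableOn G (Ioi 0) :=
        integrableOn_rpow_mul_exp_neg_mul_rpow (by linarith) hq0 hc
      have hle : ∫ t in Ioi 1, G t ≤ ∫ t in Ioi 0, G t := by
        refine setIntegral_mono_set hG0 ?_ h01.eventuallyLE
        refine (ae_restrict_iff' measurableSet_Ioi).2 (Eventually.of_forall fun t ht => ?_)
        have : (0 : ℝ) < t := ht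
        show 0 ≤ G t
        positivity
      rw [integral_rpow_mul_exp_neg_mul_rpow hq0 (by linarith) hc, sub_add_cancel] at hle
      have h3 := mul_le_mul_of_nonneg_left hle (abs_nonneg s)
      have h4 : A * c ^ (-s / q) ≤ |A| * c ^ (-s / q) :=
        mul_le_mul_of_nonneg_right (le_abs_self A) hcp.le
      have h5 : |s| * (c ^ (-s / q) * (1 / q) * Gamma (s / q)) = A * c ^ (-s / q) := by
        rw [hA]; ring
      linarith
  have hDle : ∫ t in Ioi 1, |s * G t - c * q * H t| ≤
      |s| * (∫ t in Ioi 1, G t) + c * q * ∫ t in Ioi 1, H t := by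
    rw [← integral_const_mul, ← integral_const_mul,
      ← integral_add (hGi.const_mul _) ((hHi.mono_set h01).const_mul _)]
    refine setIntegral_mono_on hDi.abs
      ((hGi.const_mul _).add ((hHi.mono_set h01).const_mul _)) measurableSet_Ioi fun t ht => ?_
    have ht0 : (0 : ℝ) < t := h01 ht
    have hGt : 0 ≤ G t := by positivity
    have hHt : 0 ≤ H t := by positivity
    refine (abs_sub _ _).trans_eq ?_
    rw [abs_mul, abs_of_nonneg hGt, abs_of_nonneg (by positivity : 0 ≤ c * q * H t)]
  have htri := abs_sub (∑' n : ℕ, F (n + 1) - ∫ t in Ioi 1, F t) (∫ t in Ioc 0 1, F t)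
  rw [sub_sub, add_comm, ← hsplit] at htri
  have h6 : 0 ≤ 1 / (s + 1) := by
    have : 0 < s + 1 := by linarith
    positivity
  have h7 : 0 ≤ |A| := abs_nonneg A
  have h8 : 0 ≤ (1 / (s + 1) + 1) * c ^ (-s / q) := by positivity
  calc _ ≤ _ := htri
    _ ≤ _ := by nlinarith

/-! ### Elementary bounds for power sums and for the product. -/

section
open Real Finset

/-- Bernoulli's inequality at 1/t, scaled by t^(a+1); the companion upper bound uses -1/(t+1). Both
feed the inductions for ∑ j^a. -/
theorem le_rpow_succ_sub {a t : ℝ} (ha : 0 ≤ a) (ht : 0 < t) :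
    (a + 1) * t ^ a ≤ (t + 1) ^ (a + 1) - t ^ (a + 1) := by
  have h := one_add_mul_self_le_rpow_one_add (s := 1 / t) (p := a + 1)
    (by have : 0 < 1 / t := by positivity
        linarith) (by linarith)
  have h2 := mul_le_mul_of_nonneg_left h (rpow_nonneg ht.le (a + 1))
  rw [← mul_rpow ht.le (by positivity)] at h2
  have e1 : t * (1 + 1 / t) = t + 1 := by field_simp
  have e2 : t ^ (a + 1) * (1 + (a + 1) * (1 / t)) = t ^ (a + 1) + (a + 1) * t ^ a := by
    rw [rpow_add_one ht.ne']
    field_simp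
  rw [e1, e2] at h2
  linarith

theorem rpow_succ_sub_le {a t : ℝ} (ha : 0 ≤ a) (ht : 0 ≤ t) :
    (t + 1) ^ (a + 1) - t ^ (a + 1) ≤ (a + 1) * (t + 1) ^ a := by
  have ht1 : 0 < t + 1 := by linarith
  have h := one_add_mul_self_le_rpow_one_add (s := -(1 / (t + 1))) (p := a + 1)
    (by have : 1 / (t + 1) ≤ 1 := by rw [div_le_one ht1]; linarith
        linarith) (by linarith)
  have h2 := mul_le_mul_of_nonneg_left h (rpow_nonneg ht1.le (a + 1))
  have e1 : (t + 1) * (1 + -(1 / (t + 1))) = t := by field_simp; ring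
  rw [← mul_rpow ht1.le (nonneg_of_mul_nonneg_right (by rw [e1]; exact ht) ht1), e1] at h2
  have e2 : (t + 1) ^ (a + 1) * (1 + (a + 1) * -(1 / (t + 1))) =
      (t + 1) ^ (a + 1) - (a + 1) * (t + 1) ^ a := by
    rw [rpow_add_one ht1.ne']
    field_simp
    ring
  rw [e2] at h2
  linarith

theorem rpow_succ_div_le_sum_rpow {a : ℝ} (ha : 0 ≤ a) (i : ℕ) :
    (i : ℝ) ^ (a + 1) / (a + 1) ≤ ∑ j ∈ Icc 1 i, (j : ℝ) ^ a := by
  induction i with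
  | zero => simp [zero_rpow (by linarith : a + 1 ≠ 0)]
  | succ n ih =>
    rw [sum_Icc_succ_top (by omega)]
    push_cast
    have h := rpow_succ_sub_le ha n.cast_nonneg
    have h1 : 0 < a + 1 := by linarith
    rw [div_le_iff₀ h1] at *
    nlinarith

theorem sum_rpow_le_rpow_succ_div_add {a : ℝ} (ha : 0 < a) (i : ℕ) :
    ∑ j ∈ Icc 1 i, (j : ℝ) ^ a ≤ (i : ℝ) ^ (a + 1) / (a + 1) + (i : ℝ) ^ a := by
  have h1 : 0 < a + 1 := by linarith
  induction i with
  | zero => simp [zero_rpow h1.ne', zero_rpow ha.ne']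
  | succ n ih =>
    rw [sum_Icc_succ_top (by omega)]
    push_cast
    -- The surplus n^a is absorbed by the next main term, so it does not accumulate.
    have h : (n : ℝ) ^ (a + 1) / (a + 1) + (n : ℝ) ^ a ≤ ((n : ℝ) + 1) ^ (a + 1) / (a + 1) := by
      rcases n.eq_zero_or_pos with rfl | hn
      · simp [zero_rpow h1.ne', zero_rpow ha.ne']
        positivity
      · have h := le_rpow_succ_sub ha.le (Nat.cast_pos.2 hn : (0 : ℝ) < n)
        rw [le_div_iff₀ h1, add_mul, div_mul_cancel₀ _ h1.ne']
        linarith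
    linarith

theorem prod_div_nonneg {a x : ℝ} (hx : 0 ≤ x) (i : ℕ) :
    0 ≤ ∏ j ∈ Icc 1 i, x / (x + (j : ℝ) ^ a) :=
  prod_nonneg fun j _ => by positivity

theorem prod_div_mono {a x y : ℝ} (hx : 0 < x) (hxy : x ≤ y) (i : ℕ) :
    ∏ j ∈ Icc 1 i, x / (x + (j : ℝ) ^ a) ≤ ∏ j ∈ Icc 1 i, y / (y + (j : ℝ) ^ a) := by
  have hy : 0 < y := by linarith
  refine prod_le_prod (fun j _ => by positivity) fun j _ => ?_
  have : 0 ≤ (j : ℝ) ^ a := by positivity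
  rw [div_le_div_iff₀ (by positivity) (by positivity)]
  nlinarith

/-- Each factor is 1/(1+u) ≥ exp(-u) with u = j^a/x; the surplus i^a in the power sum costs
exp(-i^a/x) ≥ 1 - i^a/x. -/
theorem exp_mul_one_sub_le_prod {a x : ℝ} (ha : 0 < a) (hx : 0 < x) (i : ℕ) :
    exp (-(1 / (a + 1) / x) * (i : ℝ) ^ (a + 1)) * (1 - (i : ℝ) ^ a / x) ≤
      ∏ j ∈ Icc 1 i, x / (x + (j : ℝ) ^ a) := by
  have h1 : exp (-((∑ j ∈ Icc 1 i, (j : ℝ) ^ a) / x)) ≤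
      ∏ j ∈ Icc 1 i, x / (x + (j : ℝ) ^ a) := by
    rw [sum_div, ← sum_neg_distrib, exp_sum]
    refine prod_le_prod (fun j _ => (exp_pos _).le) fun j _ => ?_
    have hj : 0 ≤ (j : ℝ) ^ a := by positivity
    have e : x / (x + (j : ℝ) ^ a) = ((j : ℝ) ^ a / x + 1)⁻¹ := by
      field_simp
      ring
    rw [exp_neg, e]
    exact inv_anti₀ (by positivity) (add_one_le_exp _)
  refine le_trans ?_ h1
  have h2 : 1 - (i : ℝ) ^ a / x ≤ exp (-((i : ℝ) ^ a / x)) := by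
    linarith [add_one_le_exp (-((i : ℝ) ^ a / x))]
  refine (mul_le_mul_of_nonneg_left h2 (exp_pos _).le).trans ?_
  rw [← exp_add, exp_le_exp]
  have h3 := div_le_div_of_nonneg_right (sum_rpow_le_rpow_succ_div_add ha i) hx.le
  have e : -(1 / (a + 1) / x) * (i : ℝ) ^ (a + 1) + -((i : ℝ) ^ a / x) =
    -(((i : ℝ) ^ (a + 1) / (a + 1) + (i : ℝ) ^ a) / x) := by
    field_simp
    ring
  rw [e]
  linarith

/-- Follows from log(1+u) ≥ 2u/(u+2) ≥ u - u²/2. -/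
theorem inv_one_add_le_exp {u : ℝ} (hu : 0 ≤ u) : (1 + u)⁻¹ ≤ exp (-u + u ^ 2 / 2) := by
  have h := le_log_one_add_of_nonneg hu
  have h2 : u - u ^ 2 / 2 ≤ 2 * u / (u + 2) := by
    rw [le_div_iff₀ (by linarith)]
    nlinarith [pow_nonneg hu 3]
  rw [← exp_log (by linarith : 0 < 1 + u), ← exp_neg, exp_le_exp]
  linarith

theorem prod_le_exp {a x : ℝ} (ha : 0 < a) (hx : 0 < x) (i : ℕ) :
    ∏ j ∈ Icc 1 i, x / (x + (j : ℝ) ^ a) ≤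
      exp (-(1 / (a + 1) / x) * (i : ℝ) ^ (a + 1) + i * ((i : ℝ) ^ a / x) ^ 2 / 2) := by
  have h1 : ∏ j ∈ Icc 1 i, x / (x + (j : ℝ) ^ a) ≤
      exp (∑ j ∈ Icc 1 i, (-((j : ℝ) ^ a / x) + ((j : ℝ) ^ a / x) ^ 2 / 2)) := by
    rw [exp_sum]
    refine prod_le_prod (fun j _ => by positivity) fun j _ => ?_
    have e : x / (x + (j : ℝ) ^ a) = (1 + (j : ℝ) ^ a / x)⁻¹ := by
      field_simp
    rw [e]
    exact inv_one_add_le_exp (by positivity)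
  refine h1.trans (exp_le_exp.2 ?_)
  rw [sum_add_distrib, sum_neg_distrib, ← sum_div]
  have h3 := div_le_div_of_nonneg_right (rpow_succ_div_le_sum_rpow ha.le i) hx.le
  have h4 : ∑ j ∈ Icc 1 i, ((j : ℝ) ^ a / x) ^ 2 / 2 ≤ i * ((i : ℝ) ^ a / x) ^ 2 / 2 := by
    have := sum_le_card_nsmul (Icc 1 i) (fun j : ℕ => ((j : ℝ) ^ a / x) ^ 2 / 2)
      (((i : ℝ) ^ a / x) ^ 2 / 2) (fun j hj => by
        have : (j : ℝ) ≤ i := by exact_mod_cast (mem_Icc.1 hj).2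
        gcongr)
    simp only [Nat.card_Icc, add_tsub_cancel_right, nsmul_eq_mul] at this
    linarith
  have e : -(1 / (a + 1) / x) * (i : ℝ) ^ (a + 1) = -((i : ℝ) ^ (a + 1) / (a + 1) / x) := by
    field_simp
  rw [e]
  linarith

/-- The threshold (a+1)i^a ≤ x is chosen so that the quadratic loss uses up at most half of the main
exponent. -/
theorem mul_sq_div_le {a x : ℝ} (ha : 0 < a) (hx : 0 < x) {i : ℕ} (hi : 1 ≤ i)
    (h : (a + 1) * (i : ℝ) ^ a ≤ x) :
    i * ((i : ℝ) ^ a / x) ^ 2 / 2 ≤ 1 / (2 * (a + 1)) / x * (i : ℝ) ^ (a + 1) := by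
  have hi0 : (0 : ℝ) < i := by exact_mod_cast hi
  have hp : 0 < (i : ℝ) ^ a := by positivity
  rw [rpow_add_one hi0.ne']
  have h1 : (i : ℝ) ^ a / x ≤ 1 / (a + 1) := by
    rw [div_le_div_iff₀ hx (by linarith)]
    linarith
  have h2 := mul_le_mul_of_nonneg_left h1 (by positivity : 0 ≤ i * ((i : ℝ) ^ a / x) / 2)
  calc _ = i * ((i : ℝ) ^ a / x) / 2 * ((i : ℝ) ^ a / x) := by ring
    _ ≤ _ := h2
    _ = _ := by field_simp

theorem prod_le_exp_half {a x : ℝ} (ha : 0 < a) (hx : 0 < x) {i : ℕ} (hi : 1 ≤ i)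
    (h : (a + 1) * (i : ℝ) ^ a ≤ x) :
    ∏ j ∈ Icc 1 i, x / (x + (j : ℝ) ^ a) ≤
      exp (-(1 / (2 * (a + 1)) / x) * (i : ℝ) ^ (a + 1)) := by
  refine (prod_le_exp ha hx i).trans (exp_le_exp.2 ?_)
  have e : 1 / (a + 1) / x * (i : ℝ) ^ (a + 1) =
    2 * (1 / (2 * (a + 1)) / x * (i : ℝ) ^ (a + 1)) := by field_simp
  linarith [mul_sq_div_le ha hx hi h]

/-- The product increases with x, so x may be raised to the threshold (a+1)i^a, where
`prod_le_exp_half` still applies and its exponent becomes linear in i. -/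
theorem prod_le_exp_neg_linear {a x : ℝ} (ha : 0 < a) (hx : 0 < x) {i : ℕ} (hi : 1 ≤ i)
    (h : x ≤ (a + 1) * (i : ℝ) ^ a) :
    ∏ j ∈ Icc 1 i, x / (x + (j : ℝ) ^ a) ≤ exp (-(1 / (2 * (a + 1) ^ 2)) * i) := by
  have hi0 : (0 : ℝ) < i := by exact_mod_cast hi
  refine (prod_div_mono hx h i).trans
    ((prod_le_exp_half ha (by positivity) hi le_rfl).trans_eq ?_)
  congr 1
  rw [rpow_add_one hi0.ne']
  field_simp

/-- The error of replacing the product by `exp (-i ^ (a + 1) / ((a + 1) x))`. -/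
theorem abs_prod_sub_exp_le {a x : ℝ} (ha : 0 < a) (hx : 0 < x) {i : ℕ} (hi : 1 ≤ i) :
    |∏ j ∈ Icc 1 i, x / (x + (j : ℝ) ^ a) - exp (-(1 / (a + 1) / x) * (i : ℝ) ^ (a + 1))| ≤
      (i : ℝ) ^ a / x * exp (-(1 / (a + 1) / x) * (i : ℝ) ^ (a + 1)) +
      i * ((i : ℝ) ^ a / x) ^ 2 / 2 * exp (-(1 / (2 * (a + 1)) / x) * (i : ℝ) ^ (a + 1)) +
      exp (-(1 / (2 * (a + 1) ^ 2)) * i) := by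
  have hlow := exp_mul_one_sub_le_prod ha hx i
  set e := exp (-(1 / (a + 1) / x) * (i : ℝ) ^ (a + 1)) with he
  set E := exp (-(1 / (2 * (a + 1)) / x) * (i : ℝ) ^ (a + 1)) with hE
  set y := i * ((i : ℝ) ^ a / x) ^ 2 / 2 with hy
  have hy0 : 0 ≤ y := by positivity
  have he0 : 0 < e := exp_pos _
  have hE0 : 0 < E := exp_pos _
  have hk := exp_pos (-(1 / (2 * (a + 1) ^ 2)) * (i : ℝ))
  have hu : 0 ≤ (i : ℝ) ^ a / x * e := by positivity
  have hyE : 0 ≤ y * E := by positivity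
  rw [abs_le]
  refine ⟨by linarith, ?_⟩
  -- Below the threshold, e·(exp y - 1) ≤ y·e·exp y ≤ y·E gives the second error term; beyond it,
  -- the product itself is at most the third.
  rcases le_total ((a + 1) * (i : ℝ) ^ a) x with h | h
  · have h1 := prod_le_exp ha hx i
    rw [exp_add, ← he, ← hy] at h1
    have h2 : e * exp y ≤ E := by
      rw [he, hE, ← exp_add, exp_le_exp]
      have e : 1 / (a + 1) / x * (i : ℝ) ^ (a + 1) =
        2 * (1 / (2 * (a + 1)) / x * (i : ℝ) ^ (a + 1)) := by field_simp
      linarith [mul_sq_div_le ha hx hi h]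
    have h3 : exp y - 1 ≤ y * exp y := by
      have := mul_le_mul_of_nonneg_right (add_one_le_exp (-y)) (exp_pos y).le
      rw [← exp_add, neg_add_cancel, exp_zero] at this
      linarith
    have h4 := mul_le_mul_of_nonneg_left h3 he0.le
    have h5 := mul_le_mul_of_nonneg_left h2 hy0
    nlinarith
  · linarith [prod_le_exp_neg_linear ha hx hi h]

end

/-! ### Summation of the errors and the asymptotics. -/

section
open Real

theorem div_rpow_neg_eq {c x r : ℝ} (hc : 0 < c) (hx : 0 < x) :
    (c / x) ^ (-r) = c ^ (-r) * x ^ r := by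
  rw [div_rpow hc.le hx.le, rpow_neg hx.le, div_inv_eq_mul]

/-- The integral scales exactly as x^((s+1)/q), which for x ≥ 1 dominates the comparison error 1 +
x^(s/q). -/
theorem tsum_rpow_mul_exp_le {q s c : ℝ} (hq : 1 ≤ q) (hs : -1 < s) (hc : 0 < c) :
    ∃ C, 0 ≤ C ∧ ∀ x : ℝ, 1 ≤ x →
      Summable (fun n : ℕ => ((n : ℝ) + 1) ^ s * exp (-(c / x) * ((n : ℝ) + 1) ^ q)) ∧
      ∑' n : ℕ, ((n : ℝ) + 1) ^ s * exp (-(c / x) * ((n : ℝ) + 1) ^ q) ≤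
        C * x ^ ((s + 1) / q) := by
  obtain ⟨C, hC, h⟩ := rpow_mul_exp_sum_sub_integral hq hs
  have hq0 : 0 < q := by linarith
  have hM : 0 ≤ Gamma ((s + 1) / q) :=
    Gamma_nonneg_of_nonneg (div_nonneg (by linarith) hq0.le)
  refine ⟨C * (1 + c ^ (-(s / q))) + c ^ (-((s + 1) / q)) * (1 / q) * Gamma ((s + 1) / q),
    by positivity, fun x hx => ?_⟩
  have hx0 : 0 < x := by linarith
  obtain ⟨h1, h2⟩ := h (c / x) (by positivity)
  refine ⟨h1, ?_⟩
  rw [integral_rpow_mul_exp_neg_mul_rpow hq0 hs (by positivity), neg_div, neg_div,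
    div_rpow_neg_eq hc hx0, div_rpow_neg_eq hc hx0] at h2
  have h3 := (abs_le.1 h2).2
  have h4 : 1 ≤ x ^ ((s + 1) / q) := one_le_rpow hx (div_nonneg (by linarith) hq0.le)
  have h5 : x ^ (s / q) ≤ x ^ ((s + 1) / q) :=
    rpow_le_rpow_of_exponent_le hx (div_le_div_of_nonneg_right (by linarith) hq0.le)
  have h6 : C * (1 + c ^ (-(s / q)) * x ^ (s / q)) ≤
      C * (1 + c ^ (-(s / q))) * x ^ ((s + 1) / q) := by
    rw [mul_assoc, add_mul, one_mul]
    gcongr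
  linarith

theorem integral_eq_kLeading {a b x : ℝ} (ha : 0 < a) (hb : -2 < b) (hx : 0 < x) :
    ∫ t in Set.Ioi (0 : ℝ), t ^ (b + 1) * exp (-(1 / (a + 1) / x) * t ^ (a + 1)) =
      kLeading a b x := by
  have ha1 : 0 < a + 1 := by linarith
  rw [integral_rpow_mul_exp_neg_mul_rpow ha1 (by linarith) (by positivity), neg_div,
    div_rpow_neg_eq (by positivity) hx, kLeading, one_div, inv_rpow ha1.le, rpow_neg ha1.le,
    inv_inv, rpow_sub ha1, rpow_one, add_assoc]
  norm_num
  field_simp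

theorem kTerm_succ (a b x : ℝ) (n : ℕ) :
    kTerm a b x (n + 1) = ((n : ℝ) + 1) ^ (b + 1) *
      ∏ j ∈ Finset.Icc 1 (n + 1), x / (x + (j : ℝ) ^ a) := by
  simp [kTerm]

/-- `abs_prod_sub_exp_le` times i^(b+1), with each term brought to the form i^s exp(-c i^q) that the
sum lemmas accept (q = 1 in the last) and a factor 1/2 dropped. -/
theorem abs_kTerm_succ_sub_le {a b x : ℝ} (ha : 0 < a) (hx : 0 < x) (n : ℕ) :
    |kTerm a b x (n + 1) -
        ((n : ℝ) + 1) ^ (b + 1) * exp (-(1 / (a + 1) / x) * ((n : ℝ) + 1) ^ (a + 1))| ≤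
      x⁻¹ * (((n : ℝ) + 1) ^ (b + 1 + a) *
        exp (-(1 / (a + 1) / x) * ((n : ℝ) + 1) ^ (a + 1))) +
      (x ^ 2)⁻¹ * (((n : ℝ) + 1) ^ (b + 2 * a + 2) *
        exp (-(1 / (2 * (a + 1)) / x) * ((n : ℝ) + 1) ^ (a + 1))) +
      ((n : ℝ) + 1) ^ (b + 1) * exp (-(1 / (2 * (a + 1) ^ 2)) * ((n : ℝ) + 1) ^ (1 : ℝ)) := by
  have h := abs_prod_sub_exp_le ha hx (Nat.le_add_left 1 n)
  have hn : (0 : ℝ) < n + 1 := by positivity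
  push_cast at h
  rw [kTerm_succ, ← mul_sub, abs_mul, abs_of_pos (rpow_pos_of_pos hn (b + 1))]
  refine (mul_le_mul_of_nonneg_left h (rpow_pos_of_pos hn (b + 1)).le).trans ?_
  have e : ((n : ℝ) + 1) ^ (b + 2 * a + 2) =
      ((n : ℝ) + 1) ^ (b + 1) * (((n : ℝ) + 1) * (((n : ℝ) + 1) ^ a) ^ 2) := by
    rw [show b + 2 * a + 2 = (b + 1) + (1 + (a + a)) by ring, rpow_add hn (b + 1), rpow_add hn 1,
      rpow_add hn a, rpow_one, sq]
  rw [rpow_one, e, rpow_add hn (b + 1) a]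
  have hpos : 0 ≤ (x ^ 2)⁻¹ * (((n : ℝ) + 1) ^ (b + 1) *
      (((n : ℝ) + 1) * (((n : ℝ) + 1) ^ a) ^ 2) *
        exp (-(1 / (2 * (a + 1)) / x) * ((n : ℝ) + 1) ^ (a + 1))) := by positivity
  have e2 : ((n : ℝ) + 1) ^ (b + 1) * (((n : ℝ) + 1) * (((n : ℝ) + 1) ^ a / x) ^ 2 / 2 *
        exp (-(1 / (2 * (a + 1)) / x) * ((n : ℝ) + 1) ^ (a + 1))) =
      (x ^ 2)⁻¹ * (((n : ℝ) + 1) ^ (b + 1) *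
      (((n : ℝ) + 1) * (((n : ℝ) + 1) ^ a) ^ 2) *
        exp (-(1 / (2 * (a + 1)) / x) * ((n : ℝ) + 1) ^ (a + 1))) / 2 := by
    field_simp
  rw [mul_add, mul_add, e2]
  have e3 : ((n : ℝ) + 1) ^ (b + 1) * (((n : ℝ) + 1) ^ a / x *
      exp (-(1 / (a + 1) / x) * ((n : ℝ) + 1) ^ (a + 1))) =
      x⁻¹ * (((n : ℝ) + 1) ^ (b + 1) * ((n : ℝ) + 1) ^ a *
        exp (-(1 / (a + 1) / x) * ((n : ℝ) + 1) ^ (a + 1))) := by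
    field_simp
  linarith

/-- With X = x^((b+1)/(a+1)), the first two error sums are O(x·X) and O(x²·X), so their prefactors
1/x and 1/x² bring both to O(X). The third sum κ does not depend on x. -/
theorem summable_kTerm_and_abs_kSum_sub_le {a b : ℝ} (ha : 0 < a) (hb : -2 < b) :
    ∃ K, 0 ≤ K ∧ ∀ x : ℝ, 1 ≤ x →
      Summable (fun n : ℕ => kTerm a b x (n + 1)) ∧
      |kSum a b x - kLeading a b x| ≤ K * (1 + x ^ ((b + 1) / (a + 1))) := by
  have ha1 : 0 < a + 1 := by linarith
  obtain ⟨C₁, hC₁, h₁⟩ := tsum_rpow_mul_exp_le (q := a + 1) (s := b + 1 + a) (c := 1 / (a + 1))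
    (by linarith) (by linarith) (by positivity)
  obtain ⟨C₂, hC₂, h₂⟩ := tsum_rpow_mul_exp_le (q := a + 1) (s := b + 2 * a + 2)
    (c := 1 / (2 * (a + 1))) (by linarith) (by linarith) (by positivity)
  obtain ⟨C₃, hC₃, h₃⟩ := rpow_mul_exp_sum_sub_integral (q := a + 1) (s := b + 1)
    (by linarith) (by linarith)
  obtain ⟨_, _, h₄⟩ := rpow_mul_exp_sum_sub_integral (q := 1) (s := b + 1) le_rfl (by linarith)
  obtain ⟨hs₄, -⟩ := h₄ (1 / (2 * (a + 1) ^ 2)) (by positivity)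
  set κ := ∑' n : ℕ, ((n : ℝ) + 1) ^ (b + 1) *
    exp (-(1 / (2 * (a + 1) ^ 2)) * ((n : ℝ) + 1) ^ (1 : ℝ)) with hκ
  have hκ0 : 0 ≤ κ := tsum_nonneg fun n => by positivity
  set D := (1 / (a + 1)) ^ (-((b + 1) / (a + 1))) with hD
  refine ⟨C₁ + C₂ + κ + C₃ * (1 + D), by positivity, fun x hx => ?_⟩
  have hx0 : 0 < x := by linarith
  obtain ⟨hs₁, hb₁⟩ := h₁ x hx
  obtain ⟨hs₂, hb₂⟩ := h₂ x hx
  obtain ⟨hs₃, hb₃⟩ := h₃ (1 / (a + 1) / x) (by positivity)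
  have hsum := ((hs₁.mul_left x⁻¹).add (hs₂.mul_left (x ^ 2)⁻¹)).add hs₄
  have hdiff := Summable.of_norm_bounded (f := fun n : ℕ => kTerm a b x (n + 1) -
    ((n : ℝ) + 1) ^ (b + 1) * exp (-(1 / (a + 1) / x) * ((n : ℝ) + 1) ^ (a + 1))) hsum
    (fun n => abs_kTerm_succ_sub_le (b := b) ha hx0 n)
  have hk : Summable (fun n : ℕ => kTerm a b x (n + 1)) := by
    simpa using hdiff.add hs₃
  refine ⟨hk, ?_⟩
  have hle := tsum_of_norm_bounded (f := fun n : ℕ => kTerm a b x (n + 1) -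
    ((n : ℝ) + 1) ^ (b + 1) * exp (-(1 / (a + 1) / x) * ((n : ℝ) + 1) ^ (a + 1))) hsum.hasSum
    (fun n => abs_kTerm_succ_sub_le (b := b) ha hx0 n)
  rw [hk.tsum_sub hs₃, ((hs₁.mul_left x⁻¹).add (hs₂.mul_left (x ^ 2)⁻¹)).tsum_add hs₄,
    (hs₁.mul_left x⁻¹).tsum_add (hs₂.mul_left (x ^ 2)⁻¹), tsum_mul_left, tsum_mul_left, ← hκ,
    norm_eq_abs] at hle
  rw [integral_eq_kLeading ha hb hx0, neg_div, div_rpow_neg_eq (by positivity) hx0, ← hD] at hb₃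
  set X := x ^ ((b + 1) / (a + 1)) with hX
  have hX0 : 0 < X := by positivity
  have e₁ : x ^ ((b + 1 + a + 1) / (a + 1)) = x * X := by
    rw [hX, mul_comm, ← rpow_add_one hx0.ne']
    congr 1
    field_simp
    ring
  have e₂ : x ^ ((b + 2 * a + 2 + 1) / (a + 1)) = x ^ 2 * X := by
    rw [hX, mul_comm, ← rpow_natCast, ← rpow_add hx0]
    congr 1
    push_cast
    field_simp
    ring
  rw [e₁] at hb₁
  rw [e₂] at hb₂
  have hb₁' := mul_le_mul_of_nonneg_left hb₁ (by positivity : 0 ≤ x⁻¹)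
  have hb₂' := mul_le_mul_of_nonneg_left hb₂ (by positivity : 0 ≤ (x ^ 2)⁻¹)
  rw [show x⁻¹ * (C₁ * (x * X)) = C₁ * X by field_simp] at hb₁'
  rw [show (x ^ 2)⁻¹ * (C₂ * (x ^ 2 * X)) = C₂ * X by field_simp] at hb₂'
  have hD0 : 0 < D := by positivity
  have htri := (abs_sub_le (kSum a b x) _ (kLeading a b x)).trans (add_le_add hle hb₃)
  have h6 : 0 ≤ κ * X := by positivity
  have h7 : 0 ≤ C₃ * D := by positivity
  have h8 : 0 ≤ C₃ * X := by positivity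
  calc _ ≤ _ := htri
    _ ≤ _ := by linarith

theorem summable_kTerm {a b x : ℝ} (ha : 0 < a) (hb : -2 < b) (hx : 0 ≤ x) :
    Summable (fun n : ℕ => kTerm a b x (n + 1)) := by
  obtain ⟨K, -, hK⟩ := summable_kTerm_and_abs_kSum_sub_le ha hb
  rcases hx.eq_or_lt with rfl | hx0
  · have : (fun n : ℕ => kTerm a b 0 (n + 1)) = fun _ => 0 := by
      funext n
      rw [kTerm_succ, Finset.prod_eq_zero (Finset.mem_Icc.2 ⟨le_rfl, by omega⟩) (zero_div _),
        mul_zero]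
    rw [this]
    exact summable_zero
  -- The estimate needs x ≥ 1; smaller x follow by monotonicity of the product in x.
  · obtain ⟨h, -⟩ := hK (max x 1) (le_max_right _ _)
    refine h.of_nonneg_of_le (fun n => ?_) fun n => ?_
    · rw [kTerm_succ]
      exact mul_nonneg (by positivity) (prod_div_nonneg hx _)
    · rw [kTerm_succ, kTerm_succ]
      exact mul_le_mul_of_nonneg_left (prod_div_mono hx0 (le_max_left _ _) _) (by positivity)

theorem kSum_sub_kLeading_isBigO {a b : ℝ} (ha : 0 < a) (hb : -2 < b) :
    (fun x : ℝ => kSum a b x - kLeading a b x) =O[atTop]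
      (fun x : ℝ => 1 + x ^ ((b + 1) / (a + 1))) := by
  obtain ⟨K, -, hK⟩ := summable_kTerm_and_abs_kSum_sub_le ha hb
  refine IsBigO.of_bound K ?_
  filter_upwards [eventually_ge_atTop 1] with x hx
  have hx0 : 0 < x := by linarith
  rw [norm_of_nonneg (by positivity : 0 ≤ 1 + x ^ ((b + 1) / (a + 1)))]
  exact (hK x hx).2

theorem rpow_isLittleO_rpow_atTop {r s : ℝ} (h : r < s) :
    (fun x : ℝ => x ^ r) =o[atTop] (fun x : ℝ => x ^ s) := by
  rw [isLittleO_iff_tendsto' ?_]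
  · refine (tendsto_rpow_neg_atTop (sub_pos.2 h)).congr' ?_
    filter_upwards [eventually_gt_atTop 0] with x hx
    rw [← rpow_sub hx, neg_sub]
  · filter_upwards [eventually_gt_atTop 0] with x hx h0
    exact absurd h0 (rpow_pos_of_pos hx s).ne'

end

theorem theorem3 (a b : ℝ) (ha : 0 < a) (hb : -2 < b) :
    (∀ x : ℝ, 0 ≤ x → Summable (fun n : ℕ => kTerm a b x (n + 1))) ∧
    ((fun x : ℝ => kSum a b x) ~[atTop] (fun x : ℝ => kLeading a b x)) ∧
    (-1 < b →
      (fun x : ℝ => kSum a b x - kLeading a b x) =O[atTop]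
        (fun x : ℝ => x ^ ((b + 1) / (a + 1)))) ∧
    (b ≤ -1 →
      (fun x : ℝ => kSum a b x - kLeading a b x) =O[atTop]
        (fun _ : ℝ => (1 : ℝ))) := by
  have ha1 : 0 < a + 1 := by linarith
  have hO := kSum_sub_kLeading_isBigO ha hb
  -- In the error 1 + x^((b+1)/(a+1)) the power dominates if b > -1 and the constant if b ≤ -1; both
  -- are negligible against x^((b+2)/(a+1)) because b + 2 > 0.
  refine ⟨fun x hx => summable_kTerm ha hb hx, ?_, fun hb1 => ?_, fun hb1 => ?_⟩
  · have hc : Real.Gamma ((b + 2) / (a + 1)) / (a + 1) ^ (1 - (b + 2) / (a + 1)) ≠ 0 :=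
      (div_pos (Real.Gamma_pos_of_pos (div_pos (by linarith) ha1))
        (Real.rpow_pos_of_pos ha1 _)).ne'
    have h0 : (fun _ : ℝ => (1 : ℝ)) =o[atTop] (fun x : ℝ => x ^ ((b + 2) / (a + 1))) := by
      simpa using rpow_isLittleO_rpow_atTop (div_pos (by linarith) ha1 : 0 < (b + 2) / (a + 1))
    have h1 := rpow_isLittleO_rpow_atTop
      (div_lt_div_of_pos_right (by linarith : b + 1 < b + 2) ha1)
    exact hO.trans_isLittleO ((h0.add h1).const_mul_right hc)
  · refine hO.trans (IsBigO.add ?_ (isBigO_refl _ _))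
    simpa using (rpow_isLittleO_rpow_atTop
      (div_pos (by linarith) ha1 : 0 < (b + 1) / (a + 1))).isBigO
  · refine hO.trans (IsBigO.add (isBigO_refl _ _) (IsBigO.of_bound 1 ?_))
    filter_upwards [eventually_ge_atTop 1] with x hx
    rw [Real.norm_of_nonneg (Real.rpow_nonneg (by linarith) _), norm_one, one_mul]
    exact Real.rpow_le_one_of_one_le_of_nonpos hx
      (div_nonpos_of_nonpos_of_nonneg (by linarith) ha1.le)
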